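/- Let $\mathcal D$ be a probability distribution on a measurable space $\mathcal Z$, let $a,b>0$, and let $\mathcal G$ be a class of measurable functions $g:\mathcal Z\to[0,b]$ with $\operatorname{Var}_{z\sim\mathcal D}[g(z)]\le a^2$ for all $g\in\mathcal G$. Assume that $\mathcal G$ is a measurable class, in the sense that for every $k\ge 0$ and every open $U\subseteq\mathbb R^k$ the set $\{(z_1,\dots,z_k): (g(z_1),\dots,g(z_k))\in U \text{ for some } g\in\mathcal G\}$ is measurable for the completion of $\mathcal D^k$ (this is automatic when $\mathcal G$ is countable). For a sample $X=(x_1,\dots,x_m)\in\mathcal Z^m$ and $r>0$, let $\mathcal N(r,\mathcal G,X)$ be the least cardinality of a set $\mathcal C\subseteq\mathcal G$ such that for every $g\in\mathcal G$ there is $g'\in\mathcal C$ with $\frac1m\sum_{i=1}^m|g(x_i)-g'(x_i)|\le r$, and let $\mathcal N(r,\mathcal G,m)=\max_{X\in\mathcal Z^m}\mathcal N(r,\mathcal G,X)$. For $n\ge1$ and $\varepsilon>0$ put $$p=\Pr_{(z_1,\dots,z_n)\sim\mathcal D^n}\Big\{\sup_{g\in\mathcal G}\Big|\frac1n\sum_{i=1}^n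 g(z_i)-\mathbb E_{z\sim\mathcal D}[g(z)]\Big|>\varepsilon\Big\}$$ (outer probability, if this set is not measurable). Then: 1. $$p\le\inf_{N\in\mathbb N,\;N\ge 2n+8b^2/\varepsilon^2}\left(16\,\mathcal N\Big(\frac{a^2}{16b},\mathcal G,N\Big)\exp\Big(-\frac{Na^4}{128b^4}\Big)+4\,\mathcal N\Big(\frac{\varepsilon n}{16N},\mathcal G,N\Big)\exp\Big(-\frac{n\varepsilon^2}{256a^2+64\varepsilon b}\Big)\right).$$ 2. If moreover $a\le b$, then, with $N$ equal to $3nb^4/a^4$ rounded to an integer, either up or down, $$p\le 20\,\mathcal N\Big(\frac{\varepsilon a^4}{48b^4},\mathcal G,N\Big)\exp\Big(-\frac{n\varepsilon^2/64}{4a^2+\varepsilon b}\Big).$$ -/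

import Mathlib

open MeasureTheory ProbabilityTheory

/-- `C` is a proper `r`-covering set of the class `H` for the sample `X = (x_1, …, x_m)`:
`C ⊆ H`, and every `g ∈ H` is within `r` of some `g' ∈ C` in the empirical `L¹` distance. -/
def IsProperCover {Z : Type*} (r : ℝ) (H : Set (Z → ℝ)) {m : ℕ} (X : Fin m → Z)
    (C : Set (Z → ℝ)) : Prop :=
  C ⊆ H ∧ ∀ g ∈ H, ∃ g' ∈ C, (1 / (m : ℝ)) * ∑ i, |g (X i) - g' (X i)| ≤ r

/-- The covering number `𝒩(r, H, X)`: the least cardinality of a proper `r`-covering set. -/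
noncomputable def sampleCoveringNumber {Z : Type*} (r : ℝ) (H : Set (Z → ℝ)) {m : ℕ}
    (X : Fin m → Z) : ℕ∞ :=
  ⨅ (C : Set (Z → ℝ)) (_ : IsProperCover r H X C), C.encard

/-- The covering number `𝒩(r, H, m)`: the largest `𝒩(r, H, X)` over samples `X` of size `m`. -/
noncomputable def coveringNumber {Z : Type*} (r : ℝ) (H : Set (Z → ℝ)) (m : ℕ) : ℕ∞ :=
  ⨆ X : Fin m → Z, sampleCoveringNumber r H X

/-- The usual measurability convention on a possibly uncountable class `H` of functions, under
which "some `g ∈ H` satisfies an open condition on a finite i.i.d. sample" is an event (up to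
a null set): the functions in `H` are measurable, and for every sample size `k` and every open
`U ⊆ ℝ^k` the set of samples `z` such that `(g(z_1), …, g(z_k)) ∈ U` for some `g ∈ H` is measurable
for the completion of `D^k`.  Countable classes of measurable functions satisfy it, and so do
classes with a countable subclass that is sequentially dense for pointwise convergence. -/
def IsMeasurableClass {Z : Type*} [MeasurableSpace Z] (D : Measure Z) (H : Set (Z → ℝ)) : Prop :=
  (∀ g ∈ H, Measurable g) ∧
    ∀ (k : ℕ) (U : Set (Fin k → ℝ)), IsOpen U →
      NullMeasurableSet {z : Fin k → Z | ∃ g ∈ H, (fun i => g (z i)) ∈ U}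
        (Measure.pi fun _ : Fin k => D)

/-- The samples `(z_1, …, z_n)` with
`sup_{g ∈ G} |(1/n) ∑ g(z_i) - E_{z ∼ D} g(z)| > ε`. -/
def deviationEvent {Z : Type*} [MeasurableSpace Z] (D : Measure Z) (G : Set (Z → ℝ)) (n : ℕ)
    (ε : ℝ) : Set (Fin n → Z) :=
  {z | ε < ⨆ g : G, |(1 / (n : ℝ)) * ∑ i, (g : Z → ℝ) (z i) - ∫ x, (g : Z → ℝ) x ∂D|}

/-! Draw a ghost sample of size m = N - n. By Chebyshev its mean is within ε/4 of the true mean with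
probability at least 1/2, so p is at most twice the probability that the two sample means differ by
more than 3ε/4 for some g (`pi_deviationEvent_le_two_mul`). The pooled sample of size N is
exchangeable, so it may be permuted at random with its values held fixed (`measure_le_of_card_le`).

If every g has empirical variance at most 5a² on the pooled sample, the first n permuted points are
a sample without replacement from a population of small variance. Bernstein's inequality
(`ncard_perm_le`) and a union bound over a cover of the pooled sample give the second term
(`pi_twoSampleEvent_sdiff_le`). Bernstein survives the lack of independence because Maclaurin's
inequality bounds the exponential moment by that of sampling with replacement.

A larger empirical variance is unlikely by another symmetrization, against a ghost sample of size N.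
Pairs are swapped by random signs, Hoeffding's inequality is applied on a cover, and the first term
results (`pi_largeVarianceEvent_le`).

The second bound is the first at N ≈ 3nb⁴/a⁴, where both exponents and both radii can be compared.
Since N is rounded, the radius allowed in `pi_deviationEvent_le` has slack: 101/1600 in place of
1/16. -/

/-! ### Symmetrization -/

/-- Measurability plays no role here: both sides may be outer measures. -/
lemma measure_le_two_mul_prod {α β : Type*} [MeasurableSpace α] [MeasurableSpace β]
    (μ : Measure α) (ν : Measure β) [SFinite ν] (A : Set α) (B : Set (α × β))
    (h : ∀ x ∈ A, 1 / 2 ≤ ν {y | (x, y) ∈ B}) : μ A ≤ 2 * (μ.prod ν) B := by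
  -- A measurable hull has the same measure, so Tonelli and Markov apply to its sections.
  set B' := toMeasurable (μ.prod ν) B
  have hB' : MeasurableSet B' := measurableSet_toMeasurable _ _
  have hsub : A ⊆ {x | (1 / 2 : ENNReal) ≤ ν (Prod.mk x ⁻¹' B')} := fun x hx =>
    (h x hx).trans (measure_mono fun _ hy => subset_toMeasurable (μ.prod ν) B hy)
  have hmarkov := mul_meas_ge_le_lintegral (μ := μ)
    (measurable_measure_prodMk_left (ν := ν) hB') (1 / 2)
  rw [← Measure.prod_apply hB', measure_toMeasurable] at hmarkov
  calc μ A ≤ μ {x | (1 / 2 : ENNReal) ≤ ν (Prod.mk x ⁻¹' B')} := measure_mono hsub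
    _ = 2 * (1 / 2 * μ {x | (1 / 2 : ENNReal) ≤ ν (Prod.mk x ⁻¹' B')}) := by
      rw [← mul_assoc, one_div, ENNReal.mul_inv_cancel (by simp) (by simp), one_mul]
    _ ≤ 2 * (μ.prod ν) B := by gcongr

section Product

variable {Z : Type*} [MeasurableSpace Z] (D : Measure Z) [IsProbabilityMeasure D]

lemma pi_le_two_mul_pi_sum {ι κ : Type*} [Fintype ι] [Fintype κ] (A : Set (ι → Z))
    (B : Set (ι ⊕ κ → Z))
    (h : ∀ x ∈ A, 1 / 2 ≤ (Measure.pi fun _ : κ => D) {y | Sum.elim x y ∈ B}) :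
    (Measure.pi fun _ : ι => D) A ≤ 2 * (Measure.pi fun _ : ι ⊕ κ => D) B := by
  have key := measure_le_two_mul_prod (Measure.pi fun _ : ι => D) (Measure.pi fun _ : κ => D) A
    {p | Sum.elim p.1 p.2 ∈ B} h
  have hmp := measurePreserving_sumPiEquivProdPi_symm (X := fun _ : ι ⊕ κ => Z) (fun _ => D)
  rw [← hmp.measure_preimage_equiv B]
  convert key using 3
  ext p
  have : (MeasurableEquiv.sumPiEquivProdPi fun _ : ι ⊕ κ => Z).symm p = Sum.elim p.1 p.2 := by
    ext i; cases i <;> rfl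
  simp [this]

lemma measurePreserving_comp_equiv {ι κ : Type*} [Fintype ι] [Fintype κ] (e : ι ≃ κ) :
    MeasurePreserving (fun (z : κ → Z) (i : ι) => z (e i)) (Measure.pi fun _ : κ => D)
      (Measure.pi fun _ : ι => D) := by
  have h := measurePreserving_piCongrLeft (α := fun _ : ι => Z) (fun _ => D) e.symm
  convert h using 1
  ext z i
  obtain ⟨k, rfl⟩ := e.symm.surjective i
  simp [MeasurableEquiv.coe_piCongrLeft]

end Product

/-- Each `T i` preserves μ, so μ B is the integral of the fraction of `i` with `T i x ∈ B`. This
reduces a probability to counting permutations or signs with the sample fixed. -/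
lemma measure_le_of_card_le {α ι : Type*} [MeasurableSpace α] (μ : Measure α)
    [IsProbabilityMeasure μ] [Fintype ι] [Nonempty ι] (T : ι → α → α)
    (hT : ∀ i, MeasurePreserving (T i) μ μ) (B : Set α) (hB : NullMeasurableSet B μ)
    (c : ℝ) (hc : ∀ x, ({i | T i x ∈ B}.ncard : ℝ) ≤ c * Fintype.card ι) :
    μ B ≤ ENNReal.ofReal c := by
  classical
  have hpre : ∀ i, NullMeasurableSet (T i ⁻¹' B) μ := fun i =>
    hB.preimage (hT i).quasiMeasurePreserving
  have hsum : (Fintype.card ι : ENNReal) * μ B =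
      ∫⁻ x, ∑ i, (T i ⁻¹' B).indicator (1 : α → ENNReal) x ∂μ := by
    have hmeas : ∀ i, AEMeasurable ((T i ⁻¹' B).indicator (1 : α → ENNReal)) μ := fun i =>
      aemeasurable_one.indicator₀ (hpre i)
    rw [lintegral_finsetSum' _ fun i _ => hmeas i]
    simp_rw [lintegral_indicator_one₀ (hpre _), (hT _).measure_preimage hB]
    simp
  have hpt : ∀ x, ∑ i, (T i ⁻¹' B).indicator (1 : α → ENNReal) x ≤
      ENNReal.ofReal (c * Fintype.card ι) := by
    intro x
    refine le_trans ?_ (ENNReal.ofReal_le_ofReal (hc x))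
    rw [ENNReal.ofReal_natCast, Set.ncard_eq_toFinset_card']
    simp [Set.indicator_apply, Finset.sum_boole, Set.mem_preimage]
  have hle : (Fintype.card ι : ENNReal) * μ B ≤ Fintype.card ι * ENNReal.ofReal c := by
    rw [hsum]
    calc _ ≤ ∫⁻ _, ENNReal.ofReal (c * Fintype.card ι) ∂μ := lintegral_mono hpt
      _ = Fintype.card ι * ENNReal.ofReal c := by
        rw [lintegral_const, measure_univ, mul_one, mul_comm c,
          ENNReal.ofReal_mul (by positivity), ENNReal.ofReal_natCast]
  exact (ENNReal.mul_le_mul_iff_right (by simp) (by simp)).1 hle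

/-! ### Measurable classes and covers over arbitrary finite index types -/

lemma IsMeasurableClass.nullMeasurableSet {Z : Type*} [MeasurableSpace Z] {D : Measure Z}
    [IsProbabilityMeasure D] {G : Set (Z → ℝ)} (hG : IsMeasurableClass D G) {ι : Type*} [Fintype ι]
    {U : Set (ι → ℝ)} (hU : IsOpen U) :
    NullMeasurableSet {z : ι → Z | ∃ g ∈ G, (fun i => g (z i)) ∈ U}
      (Measure.pi fun _ : ι => D) := by
  let e := (Fintype.equivFin ι).symm
  have hU' : IsOpen {w : Fin (Fintype.card ι) → ℝ | (fun i => w (e.symm i)) ∈ U} :=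
    hU.preimage (by fun_prop)
  have h := (hG.2 _ _ hU').preimage (measurePreserving_comp_equiv D e).quasiMeasurePreserving
  simpa [Set.preimage] using h

lemma sampleCoveringNumber_eq_encard {Z : Type*} (r : ℝ) (G : Set (Z → ℝ)) {m : ℕ}
    (X : Fin m → Z) (h : sampleCoveringNumber r G X ≠ ⊤) :
    ∃ C, IsProperCover r G X C ∧ C.encard = sampleCoveringNumber r G X := by
  have heq : sampleCoveringNumber r G X = ⨅ C : {C // IsProperCover r G X C}, C.1.encard :=
    (iInf_subtype' (f := fun C _ => Set.encard C))
  rw [heq] at h ⊢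
  have : Nonempty {C // IsProperCover r G X C} := by
    by_contra hne
    rw [not_nonempty_iff] at hne
    exact h (iInf_of_empty _)
  obtain ⟨C, hC⟩ := ENat.exists_eq_iInf fun C : {C // IsProperCover r G X C} => C.1.encard
  exact ⟨C.1, C.2, hC⟩

lemma exists_finset_cover {Z : Type*} {r : ℝ} {G : Set (Z → ℝ)} {N : ℕ} (hN : 0 < N)
    {ι : Type*} [Fintype ι] (hι : Fintype.card ι = N) (X : ι → Z)
    (h : coveringNumber r G N ≠ ⊤) :
    ∃ C : Finset (Z → ℝ), (∀ g ∈ C, g ∈ G) ∧ C.card ≤ (coveringNumber r G N).toNat ∧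
      ∀ g ∈ G, ∃ g' ∈ C, ∑ i, |g (X i) - g' (X i)| ≤ N * r := by
  let e : Fin N ≃ ι := (Fintype.equivFinOfCardEq hι).symm
  have hle : sampleCoveringNumber r G (fun i => X (e i)) ≤ coveringNumber r G N :=
    le_iSup (fun Y : Fin N → Z => sampleCoveringNumber r G Y) _
  obtain ⟨C, hC, hcard⟩ := sampleCoveringNumber_eq_encard r G (fun i => X (e i))
    (ne_top_of_le_ne_top h hle)
  have hfin : C.Finite := Set.finite_of_encard_le_coe (k := (coveringNumber r G N).toNat) (by
    rw [hcard, ENat.natCast_toNat h]; exact hle)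
  refine ⟨hfin.toFinset, fun g hg => hC.1 (hfin.mem_toFinset.1 hg), ?_, fun g hg => ?_⟩
  · rw [← Set.ncard_eq_toFinset_card C hfin]
    rw [← hcard] at hle
    exact ENat.toNat_le_toNat hle h
  · obtain ⟨g', hg', hle'⟩ := hC.2 g hg
    refine ⟨g', hfin.mem_toFinset.2 hg', ?_⟩
    rw [← e.sum_comp fun i => |g (X i) - g' (X i)|]
    have hN' : (0 : ℝ) < N := by exact_mod_cast hN
    rwa [one_div, inv_mul_le_iff₀ hN'] at hle'

lemma coveringNumber_antitone {Z : Type*} (G : Set (Z → ℝ)) (m : ℕ) :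
    Antitone fun r => coveringNumber r G m := fun _ _ hrs =>
  iSup_mono fun _ => le_iInf₂ fun C hC =>
    iInf₂_le C ⟨hC.1, fun g hg => (hC.2 g hg).imp fun _ h => ⟨h.1, h.2.trans hrs⟩⟩

/-- Serves to make a bound trivial as soon as its exponential factor, with its constant, is at least
1. -/
lemma one_le_coveringNumber {Z : Type*} [Nonempty Z] (r : ℝ) {G : Set (Z → ℝ)} (hG : G.Nonempty)
    (m : ℕ) : 1 ≤ coveringNumber r G m := by
  obtain ⟨z⟩ := ‹Nonempty Z›
  refine le_trans (le_iInf₂ fun C hC => ?_)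
    (le_iSup (fun X : Fin m → Z => sampleCoveringNumber r G X) fun _ => z)
  obtain ⟨g, hg⟩ := hG
  obtain ⟨g', hg', -⟩ := hC.2 g hg
  exact Set.one_le_encard_iff_nonempty.2 ⟨g', hg'⟩

/-! ### Random signs -/

/-- The sign `±1` attached to a Boolean. -/
def boolSign (s : Bool) : ℝ := if s then -1 else 1

lemma abs_boolSign (s : Bool) : |boolSign s| = 1 := by cases s <;> simp [boolSign]

/-- The sum over sign vectors factors into terms 2 cosh(w i), and cosh x ≤ exp(x²/2). -/
lemma sum_exp_boolSign_le {ι : Type*} [Fintype ι] [DecidableEq ι] (w : ι → ℝ) :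
    ∑ s : ι → Bool, Real.exp (∑ i, boolSign (s i) * w i) ≤
      2 ^ Fintype.card ι * Real.exp (∑ i, w i ^ 2 / 2) := by
  have h := Finset.prod_univ_sum (fun _ : ι => (Finset.univ : Finset Bool))
    fun i s => Real.exp (boolSign s * w i)
  simp only [Fintype.piFinset_univ] at h
  simp_rw [Real.exp_sum, ← h]
  calc ∏ i, ∑ s : Bool, Real.exp (boolSign s * w i) ≤ ∏ i, (2 * Real.exp (w i ^ 2 / 2)) := by
        refine Finset.prod_le_prod (fun i _ => by positivity) fun i _ => ?_
        have := Real.cosh_le_exp_half_sq (w i)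
        rw [Real.cosh_eq] at this
        simp [boolSign]
        linarith
    _ = _ := by simp [Finset.prod_mul_distrib]

/-- Exponential Chebyshev inequality for the uniform distribution on a finite type. -/
lemma ncard_lt_le_exp {κ : Type*} [Fintype κ] (Y : κ → ℝ) (t M : ℝ)
    (h : ∑ k, Real.exp (Y k) ≤ Fintype.card κ * M) :
    ({k | t < Y k}.ncard : ℝ) ≤ M * Real.exp (-t) * Fintype.card κ := by
  classical
  have h1 : ({k | t < Y k}.ncard : ℝ) ≤ ∑ k, Real.exp (Y k - t) := by
    rw [Set.ncard_eq_toFinset_card', Finset.card_eq_sum_ones, Nat.cast_sum]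
    refine (Finset.sum_le_sum fun k hk => ?_).trans
      (Finset.sum_le_sum_of_subset_of_nonneg (Finset.subset_univ _) fun _ _ _ => by positivity)
    simp only [Set.mem_toFinset, Set.mem_ofPred_eq] at hk
    simpa using (Real.one_le_exp (by linarith : 0 ≤ Y k - t))
  refine h1.trans ?_
  simp_rw [sub_eq_add_neg, Real.exp_add, ← Finset.sum_mul]
  calc _ ≤ (Fintype.card κ * M) * Real.exp (-t) := by gcongr
    _ = _ := by ring

lemma ncard_lt_abs_le {κ : Type*} [Fintype κ] (Y : κ → ℝ) (t c : ℝ)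
    (h1 : ({k | t < Y k}.ncard : ℝ) ≤ c) (h2 : ({k | t < -Y k}.ncard : ℝ) ≤ c) :
    ({k | t < |Y k|}.ncard : ℝ) ≤ 2 * c := by
  have hsub : {k | t < |Y k|} = {k | t < Y k} ∪ {k | t < -Y k} := by
    ext k; simp [lt_abs]
  rw [hsub]
  have : (({k | t < Y k} ∪ {k | t < -Y k}).ncard : ℝ) ≤
      {k | t < Y k}.ncard + {k | t < -Y k}.ncard := by
    exact_mod_cast Set.ncard_union_le {k | t < Y k} {k | t < -Y k}
  linarith

/-- Hoeffding's inequality for a sum with random signs. -/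
lemma ncard_boolSign_le {ι : Type*} [Fintype ι] [DecidableEq ι] [Nonempty ι] (v : ι → ℝ) (B t : ℝ)
    (hB : 0 < B) (hv : ∀ i, |v i| ≤ B) (ht : 0 < t) :
    ({s : ι → Bool | Fintype.card ι * t < |∑ i, boolSign (s i) * v i|}.ncard : ℝ) ≤
      2 * (Real.exp (-(Fintype.card ι * t ^ 2 / (2 * B ^ 2))) * Fintype.card (ι → Bool)) := by
  set N : ℝ := (Fintype.card ι : ℝ)
  have hN : 0 < N := by simp [N, Fintype.card_pos]
  have key : ∀ u : ι → ℝ, (∀ i, |u i| ≤ B) →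
      ({s : ι → Bool | N * t < ∑ i, boolSign (s i) * u i}.ncard : ℝ) ≤
      Real.exp (-(N * t ^ 2 / (2 * B ^ 2))) * Fintype.card (ι → Bool) := by
    intro u hu
    -- The minimizer of l²B²/2 - lt.
    set l := t / B ^ 2
    have hl : 0 < l := by positivity
    have hmgf := sum_exp_boolSign_le fun i => l * u i
    have hsq : ∑ i, (l * u i) ^ 2 / 2 ≤ N * (l ^ 2 * B ^ 2 / 2) := by
      calc ∑ i, (l * u i) ^ 2 / 2 ≤ ∑ _i : ι, l ^ 2 * B ^ 2 / 2 := by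
            refine Finset.sum_le_sum fun i _ => ?_
            rw [mul_pow]
            have : u i ^ 2 ≤ B ^ 2 := sq_le_sq' (abs_le.1 (hu i)).1 (abs_le.1 (hu i)).2
            gcongr
        _ = _ := by simp [N]
    have h := ncard_lt_le_exp (fun s : ι → Bool => ∑ i, boolSign (s i) * (l * u i)) (l * (N * t))
      (Real.exp (N * (l ^ 2 * B ^ 2 / 2))) (by
        refine hmgf.trans ?_
        simp only [Fintype.card_fun, Fintype.card_bool]
        push_cast
        gcongr)
    rw [← Real.exp_add] at h
    have hset : {s : ι → Bool | N * t < ∑ i, boolSign (s i) * u i} =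
        {s : ι → Bool | l * (N * t) < ∑ i, boolSign (s i) * (l * u i)} := by
      ext s
      have : ∑ i, boolSign (s i) * (l * u i) = l * ∑ i, boolSign (s i) * u i := by
        rw [Finset.mul_sum]; exact Finset.sum_congr rfl fun i _ => by ring
      simp [this, hl]
    rw [hset]
    convert h using 3
    simp only [l]
    field_simp
    ring
  refine ncard_lt_abs_le _ _ _ (key v hv) ?_
  simpa using key (fun i => -v i) (by simpa using hv)

/-! ### Sampling without replacement -/

/-- Maclaurin's inequality, for the random permutations of a finite type. -/
lemma sum_perm_prod_le {ι : Type*} [Fintype ι] [DecidableEq ι] (w : ι → ℝ) (hw : ∀ i, 0 ≤ w i)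
    (s : Finset ι) :
    (Fintype.card ι : ℝ) ^ s.card * ∑ p : Equiv.Perm ι, ∏ i ∈ s, w (p i) ≤
      Fintype.card (Equiv.Perm ι) * (∑ i, w i) ^ s.card := by
  induction s using Finset.induction_on with
  | empty => simp
  | insert j s hj ih =>
    set P := ∑ p : Equiv.Perm ι, ∏ i ∈ insert j s, w (p i) with hP
    -- A fresh draw j may be replaced by any draw k. Outside `s` this is an equality by symmetry;
    -- inside, w(p j) w(p k) is at most the mean of the two squares, whose sums agree under the swap
    -- of j and k. Summing over k then turns w(p k) into the total weight.
    have hstep : ∀ k, P ≤ ∑ p : Equiv.Perm ι, (∏ i ∈ s, w (p i)) * w (p k) := by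
      intro k
      by_cases hk : k ∈ s
      · have hkj : k ≠ j := fun h => hj (h ▸ hk)
        set Q : Equiv.Perm ι → ℝ := fun p => ∏ i ∈ s.erase k, w (p i)
        have hQ0 : ∀ p, 0 ≤ Q p := fun p => Finset.prod_nonneg fun _ _ => hw _
        have e1 : ∀ p : Equiv.Perm ι, ∏ i ∈ s, w (p i) = w (p k) * Q p := fun p =>
          (Finset.mul_prod_erase s (fun i => w (p i)) hk).symm
        have hswap : ∑ p : Equiv.Perm ι, Q p * w (p k) ^ 2 = ∑ p, Q p * w (p j) ^ 2 := by
          rw [← Equiv.sum_comp (Equiv.mulRight (Equiv.swap j k)) fun p => Q p * w (p j) ^ 2]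
          refine Finset.sum_congr rfl fun p _ => ?_
          simp only [Q, Equiv.coe_mulRight, Equiv.Perm.mul_apply, Equiv.swap_apply_left]
          congr 1
          refine Finset.prod_congr rfl fun i hi => ?_
          rw [Equiv.swap_apply_of_ne_of_ne]
          · rintro rfl; exact hj (Finset.mem_of_mem_erase hi)
          · exact Finset.ne_of_mem_erase hi
        calc P = ∑ p, Q p * (w (p j) * w (p k)) := by
              rw [hP]
              refine Finset.sum_congr rfl fun p _ => ?_
              rw [Finset.prod_insert hj, e1]; ring
          _ ≤ ∑ p, Q p * ((w (p k) ^ 2 + w (p j) ^ 2) / 2) := by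
              refine Finset.sum_le_sum fun p _ => mul_le_mul_of_nonneg_left ?_ (hQ0 p)
              nlinarith [sq_nonneg (w (p k) - w (p j))]
          _ = (∑ p, Q p * w (p k) ^ 2 + ∑ p, Q p * w (p j) ^ 2) / 2 := by
              rw [← Finset.sum_add_distrib, Finset.sum_div]
              exact Finset.sum_congr rfl fun p _ => by ring
          _ = ∑ p : Equiv.Perm ι, (∏ i ∈ s, w (p i)) * w (p k) := by
              rw [← hswap, add_self_div_two]
              exact Finset.sum_congr rfl fun p _ => by rw [e1]; ring
      · refine le_of_eq ?_
        rw [hP, ← Equiv.sum_comp (Equiv.mulRight (Equiv.swap j k))]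
        refine Finset.sum_congr rfl fun p _ => ?_
        rw [Finset.prod_insert hj, mul_comm]
        simp only [Equiv.coe_mulRight, Equiv.Perm.mul_apply, Equiv.swap_apply_left]
        congr 1
        refine Finset.prod_congr rfl fun i hi => ?_
        rw [Equiv.swap_apply_of_ne_of_ne]
        · rintro rfl; exact hj hi
        · rintro rfl; exact hk hi
    have hmul : (Fintype.card ι : ℝ) * P ≤
        (∑ i, w i) * ∑ p : Equiv.Perm ι, ∏ i ∈ s, w (p i) := by
      calc (Fintype.card ι : ℝ) * P = ∑ _k : ι, P := by simp
        _ ≤ ∑ k, ∑ p : Equiv.Perm ι, (∏ i ∈ s, w (p i)) * w (p k) :=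
            Finset.sum_le_sum fun k _ => hstep k
        _ = ∑ p : Equiv.Perm ι, (∏ i ∈ s, w (p i)) * ∑ k, w (p k) := by
            rw [Finset.sum_comm]; simp_rw [Finset.mul_sum]
        _ = _ := by
            simp_rw [Equiv.sum_comp _ w, ← Finset.sum_mul]
            exact mul_comm _ _
    rw [Finset.card_insert_of_notMem hj, pow_succ, pow_succ]
    have hS : 0 ≤ ∑ i, w i := Finset.sum_nonneg fun i _ => hw i
    calc (Fintype.card ι : ℝ) ^ s.card * Fintype.card ι * P
        = (Fintype.card ι : ℝ) ^ s.card * (Fintype.card ι * P) := by ring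
      _ ≤ (Fintype.card ι : ℝ) ^ s.card *
          ((∑ i, w i) * ∑ p : Equiv.Perm ι, ∏ i ∈ s, w (p i)) := by gcongr
      _ = ((Fintype.card ι : ℝ) ^ s.card * ∑ p : Equiv.Perm ι, ∏ i ∈ s, w (p i)) *
          ∑ i, w i := by ring
      _ ≤ (Fintype.card (Equiv.Perm ι) * (∑ i, w i) ^ s.card) * ∑ i, w i := by gcongr
      _ = _ := by ring

/-- Bernstein's inequality for sampling without replacement: `v` is centred, bounded by `b`, and
has mean square at most `V`. -/
lemma ncard_perm_le {ι : Type*} [Fintype ι] [DecidableEq ι] [Nonempty ι] (v : ι → ℝ)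
    (s : Finset ι) (b V t : ℝ) (hb : 0 < b) (hV : 0 < V) (ht : 0 < t)
    (hvb : ∀ i, |v i| ≤ b) (hmean : ∑ i, v i = 0) (hsq : ∑ i, v i ^ 2 ≤ Fintype.card ι * V) :
    ({p : Equiv.Perm ι | s.card * t < |∑ i ∈ s, v (p i)|}.ncard : ℝ) ≤
      2 * (Real.exp (-(s.card * t ^ 2 / (4 * V + 2 * b * t))) *
        Fintype.card (Equiv.Perm ι)) := by
  set N : ℝ := (Fintype.card ι : ℝ) with hNdef
  have hN : 0 < N := by simp [N, Fintype.card_pos]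
  have key : ∀ u : ι → ℝ, (∀ i, |u i| ≤ b) → (∑ i, u i = 0) → (∑ i, u i ^ 2 ≤ N * V) →
      ({p : Equiv.Perm ι | s.card * t < ∑ i ∈ s, u (p i)}.ncard : ℝ) ≤
      Real.exp (-(s.card * t ^ 2 / (4 * V + 2 * b * t))) * Fintype.card (Equiv.Perm ι) := by
    intro u hu hu0 hu2
    -- The minimizer t/(2V) of l²V - lt, damped so that lb ≤ 1 and exp x ≤ 1 + x + x² applies to x =
    -- l u i.
    set l := t / (2 * V + b * t)
    have hden : 0 < 2 * V + b * t := by positivity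
    have hl : 0 < l := by positivity
    have hlb : l * b ≤ 1 := by
      simp only [l]
      rw [div_mul_eq_mul_div, div_le_one hden]
      nlinarith
    have hw : ∑ i, Real.exp (l * u i) ≤ N * Real.exp (l ^ 2 * V) := by
      have h1 : ∀ i, Real.exp (l * u i) ≤ 1 + l * u i + l ^ 2 * u i ^ 2 := by
        intro i
        have hx : |l * u i| ≤ 1 := by
          rw [abs_mul, abs_of_pos hl]
          exact (mul_le_mul_of_nonneg_left (hu i) hl.le).trans hlb
        have := (abs_le.1 (Real.abs_exp_sub_one_sub_id_le hx)).2
        rw [mul_pow] at this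
        linarith
      calc ∑ i, Real.exp (l * u i) ≤ ∑ i, (1 + l * u i + l ^ 2 * u i ^ 2) :=
            Finset.sum_le_sum fun i _ => h1 i
        _ = N + l ^ 2 * ∑ i, u i ^ 2 := by
            simp_rw [Finset.sum_add_distrib, ← Finset.mul_sum, hu0]
            simp [N]
        _ ≤ N + l ^ 2 * (N * V) := by gcongr
        _ = N * (l ^ 2 * V + 1) := by ring
        _ ≤ N * Real.exp (l ^ 2 * V) := by gcongr; exact Real.add_one_le_exp _
    have hmac := sum_perm_prod_le (fun i => Real.exp (l * u i)) (fun i => (Real.exp_pos _).le) s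
    have hmgf : ∑ p : Equiv.Perm ι, Real.exp (∑ i ∈ s, l * u (p i)) ≤
        Fintype.card (Equiv.Perm ι) * Real.exp (s.card * (l ^ 2 * V)) := by
      simp_rw [Real.exp_sum]
      have hNpow : 0 < N ^ s.card := by positivity
      refine le_of_mul_le_mul_left ?_ hNpow
      calc _ ≤ _ := hmac
        _ ≤ Fintype.card (Equiv.Perm ι) * (N * Real.exp (l ^ 2 * V)) ^ s.card := by
            gcongr
        _ = _ := by rw [mul_pow, ← Real.exp_nat_mul]; ring
    have h := ncard_lt_le_exp (fun p : Equiv.Perm ι => ∑ i ∈ s, l * u (p i))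
      (l * (s.card * t)) _ hmgf
    rw [← Real.exp_add] at h
    have hset : {p : Equiv.Perm ι | s.card * t < ∑ i ∈ s, u (p i)} =
        {p : Equiv.Perm ι | l * (s.card * t) < ∑ i ∈ s, l * u (p i)} := by
      ext p
      rw [Set.mem_ofPred_eq, Set.mem_ofPred_eq, ← Finset.mul_sum, mul_lt_mul_iff_right₀ hl]
    rw [hset]
    refine h.trans ?_
    gcongr
    have hexp : l ^ 2 * V - l * t ≤ -(t ^ 2 / (4 * V + 2 * b * t)) := by
      have : l ^ 2 * V - l * t + t ^ 2 / (4 * V + 2 * b * t) =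
          - (t ^ 3 * b) / (2 * (2 * V + b * t) ^ 2) := by
        simp only [l]
        have : 4 * V + 2 * b * t = 2 * (2 * V + b * t) := by ring
        rw [this]
        field_simp
        ring
      have h0 : - (t ^ 3 * b) / (2 * (2 * V + b * t) ^ 2) ≤ 0 := by
        apply div_nonpos_of_nonpos_of_nonneg <;> [simp; skip] <;> positivity
      linarith
    calc s.card * (l ^ 2 * V) + -(l * (s.card * t)) = s.card * (l ^ 2 * V - l * t) := by ring
      _ ≤ s.card * -(t ^ 2 / (4 * V + 2 * b * t)) := by gcongr
      _ = _ := by ring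
  refine ncard_lt_abs_le _ _ _ (key v hvb hmean hsq) ?_
  simpa using key (fun i => -v i) (by simpa using hvb) (by simpa using hmean) (by simpa using hsq)

/-! ### Large empirical variances -/

/-! ### Chebyshev and Markov estimates for ghost samples -/

section Ghost

variable {Z : Type*} [MeasurableSpace Z] (D : Measure Z) [IsProbabilityMeasure D]

lemma half_le_measure_compl {α : Type*} [MeasurableSpace α] (μ : Measure α)
    [IsProbabilityMeasure μ] {s : Set α} (hs : MeasurableSet s) (h : μ s ≤ 1 / 2) :
    1 / 2 ≤ μ sᶜ := by
  rw [prob_compl_eq_one_sub hs]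
  calc (1 / 2 : ENNReal) = 1 - 1 / 2 := by rw [one_div, ENNReal.one_sub_inv_two]
    _ ≤ 1 - μ s := tsub_le_tsub_left h 1

lemma memLp_of_mem_Icc {b : ℝ} {g : Z → ℝ} (hg : Measurable g)
    (hgb : ∀ z, g z ∈ Set.Icc 0 b) (p : ENNReal) : MemLp g p D :=
  MemLp.of_bound hg.aestronglyMeasurable b (ae_of_all _ fun z => by
    rw [Real.norm_eq_abs, abs_of_nonneg (hgb z).1]; exact (hgb z).2)

/-- Chebyshev's inequality for a sample mean. -/
lemma half_le_pi_mean_close {b : ℝ} {g : Z → ℝ} (hg : Measurable g)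
    (hgb : ∀ z, g z ∈ Set.Icc 0 b) {κ : Type*} [Fintype κ] [Nonempty κ] (t : ℝ) (ht : 0 < t)
    (hcard : b ^ 2 / (2 * t ^ 2) ≤ Fintype.card κ) :
    1 / 2 ≤ (Measure.pi fun _ : κ => D)
      {y | |(1 / (Fintype.card κ : ℝ)) * ∑ i, g (y i) - ∫ x, g x ∂D| < t} := by
  set m : ℝ := (Fintype.card κ : ℝ) with hmdef
  have hm : 0 < m := by simp [m, Fintype.card_pos]
  set μ := Measure.pi fun _ : κ => D
  let Y : (κ → Z) → ℝ := ∑ i, fun y => g (y i)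
  have hYa : ∀ y, Y y = ∑ i, g (y i) := fun y => by simp [Y]
  have hLp : ∀ i : κ, MemLp (fun y : κ → Z => g (y i)) 2 μ := fun i =>
    (memLp_of_mem_Icc D hg hgb 2).comp_measurePreserving (measurePreserving_eval (fun _ => D) i)
  have hY : MemLp Y 2 μ := memLp_finsetSum' _ fun i _ => hLp i
  have hvar : variance Y μ ≤ m * (b / 2) ^ 2 := by
    have h := variance_sum_pi (μ := fun _ : κ => D) (X := fun _ => g)
      fun _ => memLp_of_mem_Icc D hg hgb 2
    have hle := variance_le_sq_of_bounded (μ := D) (ae_of_all _ hgb) hg.aemeasurable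
    rw [sub_zero] at hle
    change variance Y μ = _ at h
    rw [h]
    calc _ ≤ ∑ _i : κ, (b / 2) ^ 2 := Finset.sum_le_sum fun _ _ => hle
      _ = _ := by simp [m]
  have hmean : ∫ y, Y y ∂μ = m * ∫ x, g x ∂D := by
    simp_rw [hYa]
    rw [integral_finsetSum _ fun i _ => (hLp i).integrable (by norm_num)]
    have : ∀ i : κ, ∫ y, g (y i) ∂μ = ∫ x, g x ∂D := fun i =>
      integral_comp_eval (μ := fun _ : κ => D) (i := i) hg.aestronglyMeasurable
    simp [this, m]
  have hcheb := meas_ge_le_variance_div_sq hY (c := m * t) (by positivity)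
  -- A variable with values in [0, b] has variance at most b²/4, so the ratio is at most b²/(4mt²).
  have hle : variance Y μ / (m * t) ^ 2 ≤ 1 / 2 := by
    rw [div_le_iff₀ (by positivity)] at hcard ⊢
    refine hvar.trans ?_
    nlinarith
  have hmeas : MeasurableSet {y | m * t ≤ |Y y - ∫ x, Y x ∂μ|} := by
    have : Measurable Y := by
      have hYe : Y = fun y => ∑ i, g (y i) := funext hYa
      rw [hYe]
      fun_prop
    exact measurableSet_le measurable_const (this.sub_const _).abs
  have := half_le_measure_compl μ hmeas (hcheb.trans
    ((ENNReal.ofReal_le_ofReal hle).trans (by simp)))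
  refine this.trans (measure_mono fun y hy => ?_)
  rw [Set.mem_compl_iff, Set.mem_ofPred_eq, not_le, hmean, hYa] at hy
  rw [Set.mem_ofPred_eq]
  have : (1 / m) * ∑ i, g (y i) - ∫ x, g x ∂D = (∑ i, g (y i) - m * ∫ x, g x ∂D) / m := by
    field_simp
  rw [this, abs_div, abs_of_pos hm, div_lt_iff₀ hm]
  linarith

/-- Markov's inequality for an empirical second moment. -/
lemma half_le_pi_sum_sq_lt {b : ℝ} {g : Z → ℝ} (hg : Measurable g)
    (hgb : ∀ z, g z ∈ Set.Icc 0 b) {κ : Type*} [Fintype κ] [Nonempty κ] (V : ℝ) (hV : 0 < V)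
    (hvar : variance g D ≤ V) :
    1 / 2 ≤ (Measure.pi fun _ : κ => D)
      {y | ∑ i, (g (y i) - ∫ x, g x ∂D) ^ 2 < Fintype.card κ * (2 * V)} := by
  set m : ℝ := (Fintype.card κ : ℝ) with hmdef
  have hm : 0 < m := by simp [m, Fintype.card_pos]
  set μ := Measure.pi fun _ : κ => D
  set c := ∫ x, g x ∂D
  have hint : Integrable (fun x => (g x - c) ^ 2) D :=
    ((memLp_of_mem_Icc D hg hgb 2).sub (memLp_const c)).integrable_sq
  have hi : ∀ i : κ, Integrable (fun y : κ → Z => (g (y i) - c) ^ 2) μ := fun i =>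
    (measurePreserving_eval (fun _ => D) i).integrable_comp_of_integrable hint
  have hsum : ∫ y, ∑ i, (g (y i) - c) ^ 2 ∂μ ≤ m * V := by
    rw [integral_finsetSum _ fun i _ => hi i]
    have : ∀ i : κ, ∫ y, (g (y i) - c) ^ 2 ∂μ = variance g D := fun i => by
      rw [variance_eq_integral hg.aemeasurable]
      exact integral_comp_eval (μ := fun _ : κ => D) (i := i) (f := fun x => (g x - c) ^ 2)
        hint.aestronglyMeasurable
    simp only [this, Finset.sum_const, Finset.card_univ, nsmul_eq_mul]
    gcongr
  have hmk := mul_meas_ge_le_integral_of_nonneg (μ := μ)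
    (f := fun y => ∑ i, (g (y i) - c) ^ 2) (ae_of_all _ fun y => Finset.sum_nonneg fun i _ => sq_nonneg (g (y i) - c))
    (integrable_finsetSum _ fun i _ => hi i) (m * (2 * V))
  have hreal : μ.real {y | m * (2 * V) ≤ ∑ i, (g (y i) - c) ^ 2} ≤ 1 / 2 := by
    have h0 : 0 < m * V := by positivity
    nlinarith
  have hmeas : MeasurableSet {y : κ → Z | m * (2 * V) ≤ ∑ i, (g (y i) - c) ^ 2} := by
    refine measurableSet_le measurable_const (Finset.measurable_sum _ fun i _ => ?_)
    exact ((hg.comp (measurable_pi_apply i)).sub_const c).pow_const 2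
  have h12 : μ {y | m * (2 * V) ≤ ∑ i, (g (y i) - c) ^ 2} ≤ 1 / 2 := by
    rw [← ENNReal.ofReal_toReal (measure_ne_top μ _)]
    exact (ENNReal.ofReal_le_ofReal hreal).trans (by simp)
  refine (half_le_measure_compl μ hmeas h12).trans (measure_mono fun y hy => ?_)
  simpa using hy

end Ghost

/-- The permutation of `ι ⊕ ι` exchanging the two copies of `i` when `s i` is true. -/
def sumSwap {ι : Type*} (s : ι → Bool) : Equiv.Perm (ι ⊕ ι) :=
  Function.Involutive.toPerm
    (Sum.elim (fun i => if s i then Sum.inr i else Sum.inl i)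
      fun i => if s i then Sum.inl i else Sum.inr i)
    (by rintro (i | i) <;> by_cases h : s i <;> simp [h])

lemma sumSwap_inl {ι : Type*} (s : ι → Bool) (i : ι) :
    sumSwap s (Sum.inl i) = if s i then Sum.inr i else Sum.inl i := rfl

lemma sumSwap_inr {ι : Type*} (s : ι → Bool) (i : ι) :
    sumSwap s (Sum.inr i) = if s i then Sum.inl i else Sum.inr i := rfl

/-- Swapping a pair flips the sign of its difference. The right side is left expanded so that the
two halves can be bounded separately. -/
lemma sub_sumSwap {ι : Type*} (s : ι → Bool) (f : ι ⊕ ι → ℝ) (i : ι) :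
    f (sumSwap s (Sum.inl i)) - f (sumSwap s (Sum.inr i)) =
      boolSign (s i) * f (Sum.inl i) - boolSign (s i) * f (Sum.inr i) := by
  cases h : s i <;> simp [sumSwap_inl, sumSwap_inr, h, boolSign]
  ring

lemma ncard_biUnion_finset_le {κ α : Type*} [Finite α] (C : Finset κ) (S : Set α)
    (E : κ → Set α) (h : S ⊆ ⋃ k ∈ C, E k) (c : ℝ) (hE : ∀ k ∈ C, ((E k).ncard : ℝ) ≤ c) :
    (S.ncard : ℝ) ≤ C.card * c := by
  have h1 : S.ncard ≤ ∑ k ∈ C, (E k).ncard :=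
    (Set.ncard_le_ncard h (Set.toFinite _)).trans (Finset.set_ncard_biUnion_le C E)
  calc (S.ncard : ℝ) ≤ ∑ k ∈ C, ((E k).ncard : ℝ) := by exact_mod_cast h1
    _ ≤ ∑ _k ∈ C, c := Finset.sum_le_sum hE
    _ = C.card * c := by simp

section Variance

variable {Z : Type*} {G : Set (Z → ℝ)} {a b : ℝ}

/-- A cover handles g, but the centre c also varies continuously. Expanding (g' - c)² = g'² - 2cg' +
c² with 0 ≤ c ≤ b reduces every c to three signed sums, of g'², bg' and b². Passing from g to g'
costs Na²/8, and 1/8 + (1 + 2 + 1)·11/32 = 3/2. Three two-sided Hoeffding bounds give the factor 6.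
-/
lemma ncard_boolSign_sq_le (ha : 0 < a) (hb : 0 < b)
    (hrange : ∀ g ∈ G, ∀ z, g z ∈ Set.Icc 0 b) {ι : Type*} [Fintype ι] [DecidableEq ι]
    [Nonempty ι] (hcov : coveringNumber (a ^ 2 / (16 * b)) G (Fintype.card ι) ≠ ⊤) (x : ι → Z) :
    ({s : ι → Bool | ∃ g ∈ G, ∃ c ∈ Set.Icc 0 b, Fintype.card ι * (3 / 2 * a ^ 2) <
        |∑ i, boolSign (s i) * (g (x i) - c) ^ 2|}.ncard : ℝ) ≤
      (coveringNumber (a ^ 2 / (16 * b)) G (Fintype.card ι)).toNat *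
        (6 * (Real.exp (-(121 / 2048 * (Fintype.card ι * a ^ 4 / b ^ 4))) *
          Fintype.card (ι → Bool))) := by
  obtain ⟨C, hCG, hCcard, hC⟩ := exists_finset_cover Fintype.card_pos rfl x hcov
  set N : ℝ := (Fintype.card ι : ℝ) with hNdef
  have hN : 0 < N := by simp [N, Fintype.card_pos]
  set q := Real.exp (-(121 / 2048 * (N * a ^ 4 / b ^ 4))) * Fintype.card (ι → Bool) with hq
  let E : (ι → ℝ) → Set (ι → Bool) := fun v =>
    {s | N * (11 / 32 * a ^ 2) < |∑ i, boolSign (s i) * v i|}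
  have hE : ∀ v : ι → ℝ, (∀ i, |v i| ≤ b ^ 2) → ((E v).ncard : ℝ) ≤ 2 * q := by
    intro v hv
    convert ncard_boolSign_le v (b ^ 2) (11 / 32 * a ^ 2) (by positivity) hv (by positivity)
      using 4
    rw [← hNdef]
    field_simp
    norm_num
  refine (ncard_biUnion_finset_le C _ (fun g' => E (fun i => g' (x i) ^ 2) ∪
    (E (fun i => b * g' (x i)) ∪ E fun _ => b ^ 2)) ?_ (6 * q) ?_).trans ?_
  · rintro s ⟨g, hg, c, hc, hlt⟩
    obtain ⟨g', hg', hle⟩ := hC g hg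
    refine Set.mem_biUnion hg' ?_
    by_contra hnot
    simp only [Set.mem_union, not_or, E, Set.mem_ofPred_eq, not_lt] at hnot
    obtain ⟨h1, h2, h3⟩ := hnot
    have hsplit : ∑ i, boolSign (s i) * (g (x i) - c) ^ 2 =
        ∑ i, boolSign (s i) * ((g (x i) - c) ^ 2 - (g' (x i) - c) ^ 2) +
        (∑ i, boolSign (s i) * g' (x i) ^ 2 - 2 * c * ∑ i, boolSign (s i) * g' (x i) +
          c ^ 2 * ∑ i, boolSign (s i)) := by
      simp_rw [Finset.mul_sum, ← Finset.sum_sub_distrib, ← Finset.sum_add_distrib]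
      exact Finset.sum_congr rfl fun i _ => by ring
    have hd : |∑ i, boolSign (s i) * ((g (x i) - c) ^ 2 - (g' (x i) - c) ^ 2)| ≤
        N * (a ^ 2 / 8) := by
      calc _ ≤ ∑ i, |boolSign (s i) * ((g (x i) - c) ^ 2 - (g' (x i) - c) ^ 2)| :=
            Finset.abs_sum_le_sum_abs _ _
        _ ≤ ∑ i, 2 * b * |g (x i) - g' (x i)| := by
            refine Finset.sum_le_sum fun i _ => ?_
            have h0 := hrange g hg (x i)
            have h0' := hrange g' (hCG g' hg') (x i)
            have : (g (x i) - c) ^ 2 - (g' (x i) - c) ^ 2 =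
              (g (x i) + g' (x i) - 2 * c) * (g (x i) - g' (x i)) := by ring
            rw [abs_mul, abs_boolSign, one_mul, this, abs_mul]
            gcongr
            rw [abs_le]
            constructor <;> linarith [h0.1, h0.2, h0'.1, h0'.2, hc.1, hc.2]
        _ = 2 * b * ∑ i, |g (x i) - g' (x i)| := by rw [Finset.mul_sum]
        _ ≤ 2 * b * (N * (a ^ 2 / (16 * b))) := by gcongr
        _ = N * (a ^ 2 / 8) := by field_simp; norm_num
    have h2' : |c * ∑ i, boolSign (s i) * g' (x i)| ≤ N * (11 / 32 * a ^ 2) := by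
      refine le_trans ?_ h2
      have : ∑ i, boolSign (s i) * (b * g' (x i)) = b * ∑ i, boolSign (s i) * g' (x i) := by
        rw [Finset.mul_sum]; exact Finset.sum_congr rfl fun i _ => by ring
      rw [this, abs_mul, abs_mul, abs_of_nonneg hc.1, abs_of_pos hb]
      gcongr
      exact hc.2
    have h3' : |c ^ 2 * ∑ i, boolSign (s i)| ≤ N * (11 / 32 * a ^ 2) := by
      refine le_trans ?_ h3
      rw [← Finset.sum_mul, mul_comm _ (b ^ 2), abs_mul, abs_mul, abs_of_nonneg (sq_nonneg c),
        abs_of_nonneg (sq_nonneg b)]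
      have := hc.1
      gcongr
      exact hc.2
    rw [hsplit] at hlt
    have := lt_abs.1 hlt
    rw [abs_le] at hd h1 h2' h3'
    rcases this with h | h <;>
      linarith [hd.1, hd.2, h1.1, h1.2, h2'.1, h2'.2, h3'.1, h3'.2]
  · intro g' hg'
    have h0 := hrange g' (hCG g' hg')
    have e1 := hE (fun i => g' (x i) ^ 2) fun i => by
      rw [abs_of_nonneg (sq_nonneg _)]
      exact pow_le_pow_left₀ (h0 _).1 (h0 _).2 2
    have e2 := hE (fun i => b * g' (x i)) fun i => by
      rw [abs_of_nonneg (mul_nonneg hb.le (h0 _).1), sq]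
      exact mul_le_mul_of_nonneg_left (h0 _).2 hb.le
    have e3 := hE (fun _ => b ^ 2) fun i => by rw [abs_of_nonneg (sq_nonneg _)]
    set E1 := E fun i => g' (x i) ^ 2
    set E2 := E fun i => b * g' (x i)
    set E3 := E fun _ => b ^ 2
    have u1 : ((E1 ∪ (E2 ∪ E3)).ncard : ℝ) ≤ E1.ncard + (E2.ncard + E3.ncard) := by
      exact_mod_cast (Set.ncard_union_le _ _).trans
        (Nat.add_le_add_left (Set.ncard_union_le _ _) _)
    linarith
  · gcongr

variable [MeasurableSpace Z] (D : Measure Z) [IsProbabilityMeasure D]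

/-- Samples on which some function of the class has a large empirical variance. -/
def largeVarianceEvent (G : Set (Z → ℝ)) (V : ℝ) (ι : Type*) [Fintype ι] : Set (ι → Z) :=
  {z | ∃ g ∈ G, Fintype.card ι * V <
    ∑ i, (g (z i) - (∑ j, g (z j)) / Fintype.card ι) ^ 2}

lemma sum_sq_sub_mean_le {ι : Type*} [Fintype ι] [Nonempty ι] (u : ι → ℝ) (c : ℝ) :
    ∑ i, (u i - (∑ j, u j) / Fintype.card ι) ^ 2 ≤ ∑ i, (u i - c) ^ 2 := by
  set N : ℝ := (Fintype.card ι : ℝ) with hNdef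
  have hN : 0 < N := by simp [N, Fintype.card_pos]
  set m := (∑ j, u j) / N with hm
  have hsum : ∑ i, (u i - m) = 0 := by
    rw [Finset.sum_sub_distrib, Finset.sum_const, Finset.card_univ, nsmul_eq_mul, ← hNdef, hm]
    field_simp
    ring
  have : ∑ i, (u i - c) ^ 2 = ∑ i, (u i - m) ^ 2 + N * (m - c) ^ 2 := by
    calc ∑ i, (u i - c) ^ 2 = ∑ i, ((u i - m) ^ 2 + 2 * (m - c) * (u i - m) + (m - c) ^ 2) :=
          Finset.sum_congr rfl fun i _ => by ring
      _ = _ := by simp [Finset.sum_add_distrib, ← Finset.mul_sum, hsum, N]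
  rw [this]
  have : 0 ≤ N * (m - c) ^ 2 := by positivity
  linarith

/-- By Markov, the ghost second moment about the true mean is below 2a² with probability at least
1/2, leaving a gap 5a² - 2a² = 3a² between the halves. One half then has a signed sum above 3a²/2,
whence 12 = 2·6. -/
lemma pi_largeVarianceEvent_le (hG : IsMeasurableClass D G) (ha : 0 < a) (hb : 0 < b)
    (hrange : ∀ g ∈ G, ∀ z, g z ∈ Set.Icc 0 b) (hvar : ∀ g ∈ G, variance g D ≤ a ^ 2)
    {ι : Type*} [Fintype ι] [Nonempty ι]
    (hcov : coveringNumber (a ^ 2 / (16 * b)) G (Fintype.card ι) ≠ ⊤) :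
    (Measure.pi fun _ : ι => D) (largeVarianceEvent G (5 * a ^ 2) ι) ≤
      2 * ENNReal.ofReal (12 * (coveringNumber (a ^ 2 / (16 * b)) G (Fintype.card ι)).toNat *
        Real.exp (-(121 / 2048 * (Fintype.card ι * a ^ 4 / b ^ 4)))) := by
  classical
  -- The relevant centre is the mean of g, but the open set may not depend on g, so c ranges over
  -- [0, b].
  let U : Set (ι ⊕ ι → ℝ) := ⋃ c ∈ Set.Icc 0 b, {w | Fintype.card ι * (3 * a ^ 2) <
    ∑ i, ((w (Sum.inl i) - c) ^ 2 - (w (Sum.inr i) - c) ^ 2)}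
  have hU : IsOpen U := isOpen_biUnion fun c _ =>
    isOpen_lt continuous_const (by fun_prop)
  set B : Set (ι ⊕ ι → Z) := {z | ∃ g ∈ G, (fun i => g (z i)) ∈ U} with hB
  have hBm := hG.nullMeasurableSet (ι := ι ⊕ ι) hU
  have hmemB : ∀ z, z ∈ B ↔ ∃ g ∈ G, ∃ c ∈ Set.Icc 0 b, Fintype.card ι * (3 * a ^ 2) <
      ∑ i, ((g (z (Sum.inl i)) - c) ^ 2 - (g (z (Sum.inr i)) - c) ^ 2) := fun z => by
    simp [B, U]
  refine (pi_le_two_mul_pi_sum D _ B ?_).trans ?_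
  · rintro x ⟨g, hg, hlt⟩
    refine (half_le_pi_sum_sq_lt D (hG.1 g hg) (hrange g hg) (κ := ι) (a ^ 2) (by positivity)
      (hvar g hg)).trans (measure_mono fun y hy => ?_)
    rw [Set.mem_ofPred_eq] at hy
    refine (hmemB _).2 ⟨g, hg, ∫ x, g x ∂D, ⟨integral_nonneg fun z => (hrange g hg z).1, ?_⟩, ?_⟩
    · calc ∫ x, g x ∂D ≤ ∫ _, b ∂D := integral_mono
            ((memLp_of_mem_Icc D (hG.1 g hg) (hrange g hg) 1).integrable le_rfl)
            (integrable_const b) fun z => (hrange g hg z).2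
        _ = b := by simp
    · have h1 := hlt.trans_le (sum_sq_sub_mean_le (fun i => g (x i)) (∫ x, g x ∂D))
      simp only [Sum.elim_inl, Sum.elim_inr, Finset.sum_sub_distrib]
      linarith
  · gcongr
    refine measure_le_of_card_le _ (fun (s : ι → Bool) z i => z (sumSwap s i))
      (fun s => measurePreserving_comp_equiv D (sumSwap s)) B hBm _ fun z => ?_
    have hx := ncard_boolSign_sq_le ha hb hrange hcov fun i => z (Sum.inl i)
    have hy := ncard_boolSign_sq_le ha hb hrange hcov fun i => z (Sum.inr i)
    set S1 := {s : ι → Bool | ∃ g ∈ G, ∃ c ∈ Set.Icc 0 b, Fintype.card ι * (3 / 2 * a ^ 2) <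
        |∑ i, boolSign (s i) * (g (z (Sum.inl i)) - c) ^ 2|}
    set S2 := {s : ι → Bool | ∃ g ∈ G, ∃ c ∈ Set.Icc 0 b, Fintype.card ι * (3 / 2 * a ^ 2) <
        |∑ i, boolSign (s i) * (g (z (Sum.inr i)) - c) ^ 2|}
    have hsub : {s : ι → Bool | (fun i => z (sumSwap s i)) ∈ B} ⊆ S1 ∪ S2 := by
      intro s hs
      obtain ⟨g, hg, c, hc, hlt⟩ := (hmemB _).1 hs
      have := fun i => sub_sumSwap s (fun k => (g (z k) - c) ^ 2) i
      simp only [this, Finset.sum_sub_distrib] at hlt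
      by_contra hnot
      simp only [Set.mem_union, not_or] at hnot
      have h1 : ¬ _ := fun h => hnot.1 ⟨g, hg, c, hc, h⟩
      have h2 : ¬ _ := fun h => hnot.2 ⟨g, hg, c, hc, h⟩
      rw [not_lt, abs_le] at h1 h2
      linarith [h1.2, h2.1]
    have hle : ({s : ι → Bool | (fun i => z (sumSwap s i)) ∈ B}.ncard : ℝ) ≤
        S1.ncard + S2.ncard := by
      exact_mod_cast (Set.ncard_le_ncard hsub (Set.toFinite _)).trans (Set.ncard_union_le _ _)
    linarith

end Variance

/-! ### Deviations between two parts of a sample with small empirical variances -/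

section Deviation

variable {Z : Type*} {G : Set (Z → ℝ)} {a b ε : ℝ}

/-- Two-sample deviations larger than `t`. -/
def twoSampleEvent (G : Set (Z → ℝ)) (t : ℝ) (ι κ : Type*) [Fintype ι] [Fintype κ] :
    Set (ι ⊕ κ → Z) :=
  {z | ∃ g ∈ G, t < |(∑ i, g (z (Sum.inl i))) / Fintype.card ι -
    (∑ i, g (z (Sum.inr i))) / Fintype.card κ|}

lemma ncard_perm_twoSample_le (ha : 0 < a) (hb : 0 < b) (hε : 0 < ε)
    (hrange : ∀ g ∈ G, ∀ z, g z ∈ Set.Icc 0 b) {ι κ : Type*} [Fintype ι] [Fintype κ]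
    [Nonempty ι] [DecidableEq ι] [DecidableEq κ] (hcard : Fintype.card ι ≤ Fintype.card κ)
    {r : ℝ} (hr : Fintype.card (ι ⊕ κ) * r ≤ 101 / 1600 * ε * Fintype.card ι)
    (hcov : coveringNumber r G (Fintype.card (ι ⊕ κ)) ≠ ⊤) (z : ι ⊕ κ → Z) :
    ({p : Equiv.Perm (ι ⊕ κ) | (fun i => z (p i)) ∈
        twoSampleEvent G (3 / 4 * ε) ι κ \ largeVarianceEvent G (5 * a ^ 2) (ι ⊕ κ)}.ncard : ℝ) ≤
      (coveringNumber r G (Fintype.card (ι ⊕ κ))).toNat *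
        (2 * (Real.exp (-(Fintype.card ι * ε ^ 2 / (256 * a ^ 2 + 64 * ε * b))) *
          Fintype.card (Equiv.Perm (ι ⊕ κ)))) := by
  obtain ⟨C, hCG, hCcard, hC⟩ := exists_finset_cover Fintype.card_pos rfl z hcov
  have hn : (0 : ℝ) < Fintype.card ι := by simp [Fintype.card_pos]
  have hnm : (Fintype.card ι : ℝ) ≤ Fintype.card κ := by exact_mod_cast hcard
  have hN : (Fintype.card (ι ⊕ κ) : ℝ) = Fintype.card ι + Fintype.card κ := by simp
  set n : ℝ := (Fintype.card ι : ℝ)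
  set m : ℝ := (Fintype.card κ : ℝ)
  set N : ℝ := (Fintype.card (ι ⊕ κ) : ℝ) with hNdef
  have hm : 0 < m := hn.trans_le hnm
  have hN0 : 0 < N := by linarith
  set t := 897 / 3200 * ε with ht
  let v : (Z → ℝ) → ι ⊕ κ → ℝ := fun g k => g (z k) - (∑ j, g (z j)) / N
  let s : Finset (ι ⊕ κ) := Finset.univ.map Function.Embedding.inl
  have hs : (s.card : ℝ) = n := by simp [s, n]
  have hsum : ∀ g : Z → ℝ, ∀ p : Equiv.Perm (ι ⊕ κ),
      ∑ k ∈ s, v g (p k) = ∑ i : ι, g (z (p (Sum.inl i))) - n * ((∑ j, g (z j)) / N) := by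
    intro g p
    simp [s, v, n]
  -- Empirical variances are permutation invariant: either all are small, or no permutation counts.
  by_cases hz : ∀ g ∈ G, ∑ i, (v g i) ^ 2 ≤ N * (5 * a ^ 2)
  swap
  · have : {p : Equiv.Perm (ι ⊕ κ) | (fun i => z (p i)) ∈
        twoSampleEvent G (3 / 4 * ε) ι κ \ largeVarianceEvent G (5 * a ^ 2) (ι ⊕ κ)} = ∅ := by
      refine Set.eq_empty_of_forall_notMem fun p hp => hp.2 ?_
      push Not at hz
      obtain ⟨g, hg, hlt⟩ := hz
      refine ⟨g, hg, ?_⟩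
      rw [Equiv.sum_comp p fun j => g (z j)]
      rwa [Equiv.sum_comp p fun j => (g (z j) - (∑ j, g (z j)) / N) ^ 2]
    rw [this]
    simp only [Set.ncard_empty, Nat.cast_zero]
    positivity
  refine (ncard_biUnion_finset_le C _ (fun g' => {p : Equiv.Perm (ι ⊕ κ) |
    s.card * t < |∑ i ∈ s, v g' (p i)|}) ?_ _ fun g' hg' => ?_).trans
      (mul_le_mul_of_nonneg_right (Nat.cast_le.2 hCcard) (by positivity))
  · rintro p ⟨⟨g, hg, hlt⟩, -⟩
    obtain ⟨g', hg', hle⟩ := hC g hg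
    refine Set.mem_biUnion hg' ?_
    rw [Set.mem_ofPred_eq, hsum, hs]
    set A := ∑ i : ι, g (z (p (Sum.inl i)))
    set A' := ∑ i : ι, g' (z (p (Sum.inl i)))
    set T := ∑ j, g (z j)
    set T' := ∑ j, g' (z j)
    set R := ∑ i, |g (z i) - g' (z i)|
    have hsplit : ∑ i : κ, g (z (p (Sum.inr i))) = T - A := by
      simp only [T, A]
      rw [← Equiv.sum_comp p fun j => g (z j), Fintype.sum_sum_type]
      ring
    rw [hsplit] at hlt
    have hT : |T - T'| ≤ R := by
      simp only [T, T', ← Finset.sum_sub_distrib]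
      exact Finset.abs_sum_le_sum_abs _ _
    have hA : |A - A'| ≤ R := by
      simp only [A, A', ← Finset.sum_sub_distrib]
      refine (Finset.abs_sum_le_sum_abs _ _).trans ?_
      simp only [R]
      rw [← Equiv.sum_comp p fun j => |g (z j) - g' (z j)|, Fintype.sum_sum_type]
      have : 0 ≤ ∑ i : κ, |g (z (p (Sum.inr i))) - g' (z (p (Sum.inr i)))| := by positivity
      linarith
    have hR0 : 0 ≤ R := by positivity
    have hR : R ≤ 101 / 1600 * ε * n := hle.trans hr
    -- Turns the two-sample difference into a deviation of the first part from the pooled mean; n ≤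
    -- m bounds the factor by 2/n.
    have hident : A / n - (T - A) / m = (A - n * (T / N)) * (N / (n * m)) := by
      rw [hN]
      field_simp
      ring
    have hfac : N / (n * m) ≤ 2 / n := by
      rw [div_le_div_iff₀ (by positivity) hn]
      nlinarith
    have h1 : 3 / 8 * ε * n < |A - n * (T / N)| := by
      rw [hident, abs_mul, abs_of_pos (by positivity : 0 < N / (n * m))] at hlt
      have h2 : 3 / 4 * ε < |A - n * (T / N)| * (2 / n) :=
        hlt.trans_le (mul_le_mul_of_nonneg_left hfac (abs_nonneg _))
      rw [← mul_div_assoc, lt_div_iff₀ hn] at h2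
      linarith
    have h3 : |n * (T / N) - n * (T' / N)| ≤ R / 2 := by
      have : n * (T / N) - n * (T' / N) = (n / N) * (T - T') := by ring
      rw [this, abs_mul, abs_of_pos (by positivity : 0 < n / N)]
      have h4 : n / N ≤ 1 / 2 := by
        rw [div_le_div_iff₀ hN0 two_pos]; linarith
      calc n / N * |T - T'| ≤ 1 / 2 * R := by gcongr
        _ = R / 2 := by ring
    have h5 : |A - n * (T / N)| ≤ |A' - n * (T' / N)| + R + R / 2 := by
      have : A - n * (T / N) = (A' - n * (T' / N)) + (A - A') -
        (n * (T / N) - n * (T' / N)) := by ring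
      rw [this]
      refine (abs_sub _ _).trans ?_
      have := abs_add_le (A' - n * (T' / N)) (A - A')
      linarith
    rw [ht]
    linarith
  · have hg := hCG g' hg'
    have h0 := hrange g' hg
    have hT0 : 0 ≤ (∑ j, g' (z j)) / N :=
      div_nonneg (Finset.sum_nonneg fun j _ => (h0 _).1) hN0.le
    have hTb : (∑ j, g' (z j)) / N ≤ b := by
      rw [div_le_iff₀ hN0]
      calc ∑ j, g' (z j) ≤ ∑ _j : ι ⊕ κ, b := Finset.sum_le_sum fun j _ => (h0 _).2
        _ = b * N := by rw [Finset.sum_const, Finset.card_univ, nsmul_eq_mul, mul_comm]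
    refine (ncard_perm_le (v g') s b (5 * a ^ 2) t hb (by positivity) (by positivity)
      (fun k => ?_) ?_ (hz g' hg)).trans ?_
    · rw [abs_le]
      constructor <;> simp only [v] <;> linarith [(h0 (z k)).1, (h0 (z k)).2]
    · simp only [v, Finset.sum_sub_distrib, Finset.sum_const, Finset.card_univ, nsmul_eq_mul]
      rw [← hNdef, mul_div_cancel₀ _ hN0.ne', sub_self]
    · refine mul_le_mul_of_nonneg_left (mul_le_mul_of_nonneg_right
        (Real.exp_le_exp.2 (neg_le_neg ?_)) (by positivity)) (by positivity)
      rw [hs, div_le_div_iff₀ (by positivity) (by positivity), ht]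
      have h1 : 0 ≤ n * ε ^ 2 * a ^ 2 := by positivity
      have h2 : 0 ≤ n * ε ^ 3 * b := by positivity
      nlinarith

lemma pi_twoSampleEvent_sdiff_le [MeasurableSpace Z] (D : Measure Z) [IsProbabilityMeasure D]
    (hG : IsMeasurableClass D G) (ha : 0 < a) (hb : 0 < b) (hε : 0 < ε)
    (hrange : ∀ g ∈ G, ∀ z, g z ∈ Set.Icc 0 b) {ι κ : Type*} [Fintype ι] [Fintype κ]
    [Nonempty ι] (hcard : Fintype.card ι ≤ Fintype.card κ)
    {r : ℝ} (hr : Fintype.card (ι ⊕ κ) * r ≤ 101 / 1600 * ε * Fintype.card ι)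
    (hcov : coveringNumber r G (Fintype.card (ι ⊕ κ)) ≠ ⊤) :
    (Measure.pi fun _ : ι ⊕ κ => D)
        (twoSampleEvent G (3 / 4 * ε) ι κ \ largeVarianceEvent G (5 * a ^ 2) (ι ⊕ κ)) ≤
      ENNReal.ofReal (2 * (coveringNumber r G (Fintype.card (ι ⊕ κ))).toNat *
        Real.exp (-(Fintype.card ι * ε ^ 2 / (256 * a ^ 2 + 64 * ε * b)))) := by
  classical
  have h1 : NullMeasurableSet (twoSampleEvent G (3 / 4 * ε) ι κ)
      (Measure.pi fun _ : ι ⊕ κ => D) :=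
    hG.nullMeasurableSet (U := {w : ι ⊕ κ → ℝ | 3 / 4 * ε < |(∑ i, w (Sum.inl i)) /
      Fintype.card ι - (∑ i, w (Sum.inr i)) / Fintype.card κ|})
      (isOpen_lt continuous_const (by fun_prop))
  have h2 : NullMeasurableSet (largeVarianceEvent G (5 * a ^ 2) (ι ⊕ κ))
      (Measure.pi fun _ : ι ⊕ κ => D) :=
    hG.nullMeasurableSet (U := {w : ι ⊕ κ → ℝ | Fintype.card (ι ⊕ κ) * (5 * a ^ 2) <
      ∑ i, (w i - (∑ j, w j) / Fintype.card (ι ⊕ κ)) ^ 2})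
      (isOpen_lt continuous_const (by fun_prop))
  refine measure_le_of_card_le _ (fun (p : Equiv.Perm (ι ⊕ κ)) z i => z (p i))
    (fun p => measurePreserving_comp_equiv D p) _ (h1.diff h2) _ fun z => ?_
  refine (ncard_perm_twoSample_le ha hb hε hrange hcard hr hcov z).trans (le_of_eq ?_)
  ring

end Deviation

/-! ### Deviations from the mean -/

section Main

variable {Z : Type*} [MeasurableSpace Z] (D : Measure Z) {G : Set (Z → ℝ)} {a b ε : ℝ}

lemma exists_of_mem_deviationEvent {n : ℕ} (hε : 0 < ε) {z : Fin n → Z}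
    (hz : z ∈ deviationEvent D G n ε) :
    ∃ g ∈ G, ε < |(1 / (n : ℝ)) * ∑ i, g (z i) - ∫ x, g x ∂D| := by
  have hz' : ε < ⨆ g : G, |(1 / (n : ℝ)) * ∑ i, (g : Z → ℝ) (z i) - ∫ x, (g : Z → ℝ) x ∂D| := hz
  rcases isEmpty_or_nonempty G with h | h
  -- For an empty class the real supremum is 0 by default, which does not exceed ε.
  · rw [Real.iSup_of_isEmpty] at hz'
    exact absurd hz' hε.not_gt
  · obtain ⟨g, hg⟩ := exists_lt_of_lt_ciSup hz'
    exact ⟨g, g.2, hg⟩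

variable [IsProbabilityMeasure D]

lemma lt_of_mem_deviationEvent (hG : ∀ g ∈ G, Measurable g) {n : ℕ} (hn : 0 < n) (hε : 0 < ε)
    (hrange : ∀ g ∈ G, ∀ z, g z ∈ Set.Icc 0 b) {z : Fin n → Z}
    (hz : z ∈ deviationEvent D G n ε) : ε < b := by
  obtain ⟨g, hg, hlt⟩ := exists_of_mem_deviationEvent D hε hz
  have hn' : (0 : ℝ) < n := by exact_mod_cast hn
  have h0 : 0 ≤ ∫ x, g x ∂D := integral_nonneg fun z => (hrange g hg z).1
  have h1 : ∫ x, g x ∂D ≤ b := by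
    calc ∫ x, g x ∂D ≤ ∫ _, b ∂D := integral_mono
          ((memLp_of_mem_Icc D (hG g hg) (hrange g hg) 1).integrable le_rfl)
          (integrable_const b) fun z => (hrange g hg z).2
      _ = b := by simp
  have h2 : 0 ≤ (1 / (n : ℝ)) * ∑ i, g (z i) :=
    mul_nonneg (by positivity) (Finset.sum_nonneg fun i _ => (hrange g hg _).1)
  have h3 : (1 / (n : ℝ)) * ∑ i, g (z i) ≤ b := by
    rw [one_div, inv_mul_le_iff₀ hn']
    calc ∑ i, g (z i) ≤ ∑ _i : Fin n, b := Finset.sum_le_sum fun i _ => (hrange g hg _).2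
      _ = n * b := by simp
  refine hlt.trans_le (abs_le.2 ⟨?_, ?_⟩) <;> linarith

lemma pi_deviationEvent_le_two_mul (hG : ∀ g ∈ G, Measurable g) (hε : 0 < ε)
    (hrange : ∀ g ∈ G, ∀ z, g z ∈ Set.Icc 0 b) (n : ℕ) {κ : Type*} [Fintype κ] [Nonempty κ]
    (hκ : 8 * b ^ 2 / ε ^ 2 ≤ Fintype.card κ) :
    (Measure.pi fun _ : Fin n => D) (deviationEvent D G n ε) ≤
      2 * (Measure.pi fun _ : Fin n ⊕ κ => D) (twoSampleEvent G (3 / 4 * ε) (Fin n) κ) := by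
  refine pi_le_two_mul_pi_sum D _ _ fun x hx => ?_
  obtain ⟨g, hg, hlt⟩ := exists_of_mem_deviationEvent D hε hx
  -- At t = ε/4 Chebyshev's requirement b²/(2t²) is exactly 8b²/ε².
  refine (half_le_pi_mean_close D (hG g hg) (hrange g hg) (κ := κ) (ε / 4) (by positivity)
    (le_trans (le_of_eq ?_) hκ)).trans (measure_mono fun y hy => ⟨g, hg, ?_⟩)
  · field_simp
    ring
  · rw [Set.mem_ofPred_eq, one_div_mul_eq_div] at hy
    rw [one_div_mul_eq_div] at hlt
    simp only [Sum.elim_inl, Sum.elim_inr, Fintype.card_fin]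
    have h := abs_sub_le ((∑ i, g (x i)) / n) ((∑ i, g (y i)) / Fintype.card κ) (∫ x, g x ∂D)
    linarith

lemma one_le_coveringNumber_toENNReal {Y : Type*} [Nonempty Y] (r : ℝ) {H : Set (Y → ℝ)}
    (hH : H.Nonempty) (m : ℕ) : 1 ≤ (coveringNumber r H m : ENNReal) := by
  rw [← ENat.toENNReal_one, ENat.toENNReal_le]
  exact one_le_coveringNumber r hH m

/-- The uniform deviation bound, for any second covering radius `r` slightly above
`ε n / (16 N)`. -/
theorem pi_deviationEvent_le (hG : IsMeasurableClass D G) (ha : 0 < a) (hb : 0 < b)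
    (hrange : ∀ g ∈ G, ∀ z, g z ∈ Set.Icc 0 b) (hvar : ∀ g ∈ G, variance g D ≤ a ^ 2)
    {n : ℕ} (hn : 0 < n) (hε : 0 < ε) {N : ℕ}
    (hN : 2 * (n : ℝ) + 8 * b ^ 2 / ε ^ 2 ≤ N) {r : ℝ} (hr : N * r ≤ 101 / 1600 * ε * n) :
    (Measure.pi fun _ : Fin n => D) (deviationEvent D G n ε) ≤
      16 * (coveringNumber (a ^ 2 / (16 * b)) G N : ENNReal) *
          ENNReal.ofReal (Real.exp (-((N : ℝ) * a ^ 4 / (128 * b ^ 4)))) +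
        4 * (coveringNumber r G N : ENNReal) *
          ENNReal.ofReal (Real.exp (-((n : ℝ) * ε ^ 2 / (256 * a ^ 2 + 64 * ε * b)))) := by
  rcases (deviationEvent D G n ε).eq_empty_or_nonempty with hempty | ⟨z, hz⟩
  · simp [hempty]
  obtain ⟨g, hg, -⟩ := exists_of_mem_deviationEvent D hε hz
  have : Nonempty Z := ⟨z ⟨0, hn⟩⟩
  have hone : (1 : ENNReal) ≤ (coveringNumber (a ^ 2 / (16 * b)) G N : ENNReal) :=
    one_le_coveringNumber_toENNReal _ ⟨g, hg⟩ N
  set F := Real.exp (-((N : ℝ) * a ^ 4 / (128 * b ^ 4))) with hF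
  set E := Real.exp (-((n : ℝ) * ε ^ 2 / (256 * a ^ 2 + 64 * ε * b))) with hE
  have hF0 : 0 < F := Real.exp_pos _
  have hE0 : 0 < E := Real.exp_pos _
  by_cases htriv : 1 ≤ 16 * F
  · refine prob_le_one.trans (le_trans ?_ le_self_add)
    calc (1 : ENNReal) ≤ ENNReal.ofReal (16 * F) := ENNReal.one_le_ofReal.2 htriv
      _ = 16 * 1 * ENNReal.ofReal F := by
        rw [ENNReal.ofReal_mul (by norm_num)]; simp
      _ ≤ _ := by gcongr
  by_cases hc1 : coveringNumber (a ^ 2 / (16 * b)) G N = ⊤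
  · simp [hc1, ENNReal.mul_top, ENNReal.top_mul, hF0]
  by_cases hc2 : coveringNumber r G N = ⊤
  · simp [hc2, ENNReal.mul_top, ENNReal.top_mul, hE0]
  have hn' : (0 : ℝ) < n := by exact_mod_cast hn
  have h8 : 0 < 8 * b ^ 2 / ε ^ 2 := by positivity
  have hnN : 2 * n ≤ N := by
    have : (2 * n : ℝ) ≤ N := by linarith
    exact_mod_cast this
  obtain ⟨m, hm⟩ : ∃ m, N = Fintype.card (Fin n ⊕ Fin m) := ⟨N - n, by simp; omega⟩
  have hNnm : N = n + m := by simpa using hm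
  have hNr : (N : ℝ) = n + m := by exact_mod_cast hNnm
  have : Nonempty (Fin n) := ⟨⟨0, hn⟩⟩
  have : Nonempty (Fin m) := ⟨⟨0, by omega⟩⟩
  have hghost := pi_deviationEvent_le_two_mul D hG.1 hε hrange n (κ := Fin m)
    (by rw [Fintype.card_fin]; linarith)
  have hS := pi_largeVarianceEvent_le D hG ha hb hrange hvar (ι := Fin n ⊕ Fin m)
    (by rwa [← hm])
  have hB := pi_twoSampleEvent_sdiff_le D hG ha hb hε hrange (ι := Fin n) (κ := Fin m)
    (by simp only [Fintype.card_fin]; omega) (r := r)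
    (by rwa [← hm, Fintype.card_fin]) (by rwa [← hm])
  rw [← hm] at hS hB
  rw [Fintype.card_fin, ← hE] at hB
  set H := Real.exp (-(121 / 2048 * (N * a ^ 4 / b ^ 4))) with hH
  -- Since 121/2048 ≥ 2/128, H ≤ F²; and F < 1/16 outside the trivial case. This turns the factor 48
  -- into 16.
  have hHF : 3 * H ≤ F := by
    have : H ≤ F * F := by
      rw [hH, hF, ← Real.exp_add]
      refine Real.exp_le_exp.2 ?_
      have h1 : (N : ℝ) * a ^ 4 / (128 * b ^ 4) = (N * a ^ 4 / b ^ 4) / 128 := by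
        field_simp
      have h2 : 0 ≤ (N : ℝ) * a ^ 4 / b ^ 4 := by positivity
      rw [h1]
      linarith
    push Not at htriv
    nlinarith
  set k₁ := (coveringNumber (a ^ 2 / (16 * b)) G N).toNat with hk₁
  set k₂ := (coveringNumber r G N).toNat with hk₂
  have e1 : (coveringNumber (a ^ 2 / (16 * b)) G N : ENNReal) = (k₁ : ENNReal) := by
    rw [← ENat.natCast_toNat hc1]; simp [hk₁]
  have e2 : (coveringNumber r G N : ENNReal) = (k₂ : ENNReal) := by
    rw [← ENat.natCast_toNat hc2]; simp [hk₂]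
  rw [e1, e2]
  have hsplit := measure_mono (μ := Measure.pi fun _ : Fin n ⊕ Fin m => D)
    (Set.subset_sdiff_union (twoSampleEvent G (3 / 4 * ε) (Fin n) (Fin m))
      (largeVarianceEvent G (5 * a ^ 2) (Fin n ⊕ Fin m)))
  calc _ ≤ _ := hghost
    _ ≤ 2 * (ENNReal.ofReal (2 * k₂ * E) + 2 * ENNReal.ofReal (12 * k₁ * H)) := by
      gcongr
      exact hsplit.trans ((measure_union_le _ _).trans (add_le_add hB hS))
    _ = ENNReal.ofReal (48 * k₁ * H + 4 * k₂ * E) := by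
      have h2 : (2 : ENNReal) = ENNReal.ofReal 2 := by simp
      rw [h2, ← ENNReal.ofReal_mul (by norm_num), ← ENNReal.ofReal_add (by positivity)
        (by positivity), ← ENNReal.ofReal_mul (by norm_num)]
      congr 1
      ring
    _ ≤ ENNReal.ofReal (16 * k₁ * F + 4 * k₂ * E) := by
      refine ENNReal.ofReal_le_ofReal ?_
      have : (0 : ℝ) ≤ k₁ := Nat.cast_nonneg _
      nlinarith
    _ = _ := by
      rw [ENNReal.ofReal_add (by positivity) (by positivity),
        ENNReal.ofReal_mul (by positivity), ENNReal.ofReal_mul (by positivity),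
        ENNReal.ofReal_mul (by positivity), ENNReal.ofReal_mul (by positivity)]
      simp

end Main

/-! ### The two bounds -/

theorem mainTheorem5 {Z : Type*} [MeasurableSpace Z] (D : Measure Z) [IsProbabilityMeasure D]
    (G : Set (Z → ℝ)) (hG : IsMeasurableClass D G)
    (a b : ℝ) (ha : 0 < a) (hb : 0 < b)
    (hrange : ∀ g ∈ G, ∀ z, g z ∈ Set.Icc 0 b)
    (hvar : ∀ g ∈ G, variance g D ≤ a ^ 2)
    (n : ℕ) (hn : 0 < n) (ε : ℝ) (hε : 0 < ε) :
    ((Measure.pi fun _ : Fin n => D) (deviationEvent D G n ε) ≤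
      ⨅ (N : ℕ) (_ : 2 * (n : ℝ) + 8 * b ^ 2 / ε ^ 2 ≤ (N : ℝ)),
        (16 * (coveringNumber (a ^ 2 / (16 * b)) G N : ENNReal) *
            ENNReal.ofReal (Real.exp (-((N : ℝ) * a ^ 4 / (128 * b ^ 4)))) +
          4 * (coveringNumber (ε * (n : ℝ) / (16 * (N : ℝ))) G N : ENNReal) *
            ENNReal.ofReal (Real.exp (-((n : ℝ) * ε ^ 2 / (256 * a ^ 2 + 64 * ε * b))))))
    ∧
    (a ≤ b → ∀ N : ℕ, |(N : ℝ) - 3 * (n : ℝ) * b ^ 4 / a ^ 4| < 1 →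
      (Measure.pi fun _ : Fin n => D) (deviationEvent D G n ε) ≤
        20 * (coveringNumber (ε * a ^ 4 / (48 * b ^ 4)) G N : ENNReal) *
          ENNReal.ofReal (Real.exp (-(((n : ℝ) * ε ^ 2 / 64) / (4 * a ^ 2 + ε * b))))) := by
  have hn' : (0 : ℝ) < n := by exact_mod_cast hn
  refine ⟨le_iInf₂ fun N hN => ?_, fun hab N hNabs => ?_⟩
  · refine pi_deviationEvent_le D hG ha hb hrange hvar hn hε hN ?_
    have : 0 < 8 * b ^ 2 / ε ^ 2 := by positivity
    have hN0 : (0 : ℝ) < N := by linarith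
    have h1 : (N : ℝ) * (ε * n / (16 * N)) = 100 / 1600 * ε * n := by
      field_simp
      norm_num
    rw [h1]
    have : 0 < ε * n := by positivity
    linarith
  rcases (deviationEvent D G n ε).eq_empty_or_nonempty with hempty | ⟨z, hz⟩
  · simp [hempty]
  have hεb : ε < b := lt_of_mem_deviationEvent D hG.1 hn hε hrange hz
  obtain ⟨g, hg, -⟩ := exists_of_mem_deviationEvent D hε hz
  have : Nonempty Z := ⟨z ⟨0, hn⟩⟩
  set r := ε * a ^ 4 / (48 * b ^ 4) with hr
  have hone : (1 : ENNReal) ≤ (coveringNumber r G N : ENNReal) :=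
    one_le_coveringNumber_toENNReal r ⟨g, hg⟩ N
  set x := ((n : ℝ) * ε ^ 2 / 64) / (4 * a ^ 2 + ε * b) with hx
  have hεb0 : 0 < ε * b := by positivity
  have ha2 : 0 < a ^ 2 := by positivity
  -- For x ≤ 2 the bound exceeds 1, as e² < 20. Otherwise 128(4a² + εb) < nε², which makes n large
  -- enough to absorb the rounding of N.
  by_cases hx2 : x ≤ 2
  · refine prob_le_one.trans ?_
    have h20 : 1 ≤ 20 * Real.exp (-x) := by
      have h1 : Real.exp x ≤ 20 := by
        calc Real.exp x ≤ Real.exp (1 + 1) := Real.exp_le_exp.2 (by linarith)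
          _ = Real.exp 1 * Real.exp 1 := Real.exp_add _ _
          _ ≤ 3 * 3 := by gcongr <;> linarith [Real.exp_one_lt_d9]
          _ ≤ 20 := by norm_num
      rw [Real.exp_neg, ← div_eq_mul_inv, le_div_iff₀ (Real.exp_pos _)]
      linarith
    calc (1 : ENNReal) ≤ ENNReal.ofReal (20 * Real.exp (-x)) := ENNReal.one_le_ofReal.2 h20
      _ = 20 * 1 * ENNReal.ofReal (Real.exp (-x)) := by
        rw [ENNReal.ofReal_mul (by norm_num)]; simp
      _ ≤ _ := by gcongr
  push Not at hx2
  rw [hx, lt_div_iff₀ (by positivity)] at hx2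
  have hn128 : 128 * b < n * ε := by nlinarith
  have hn1 : (128 : ℝ) < n := by nlinarith
  set ρ := b ^ 4 / a ^ 4 with hρ
  have hρ1 : 1 ≤ ρ := by
    rw [hρ, one_le_div (by positivity)]
    exact pow_le_pow_left₀ ha.le hab 4
  have hNρ : 3 * (n : ℝ) * b ^ 4 / a ^ 4 = 3 * n * ρ := by rw [hρ]; ring
  rw [hNρ, abs_lt] at hNabs
  have hrρ : r = ε / 48 / ρ := by rw [hr, hρ]; field_simp
  -- Of 3nρ, two thirds cover 2n and the last third is at least 512b²/ε², enough for 8b²/ε² and the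
  -- rounding loss of 1.
  have hN : 2 * (n : ℝ) + 8 * b ^ 2 / ε ^ 2 ≤ N := by
    have hβ1 : 1 ≤ b ^ 2 / ε ^ 2 := by
      rw [one_le_div (by positivity)]
      exact pow_le_pow_left₀ hε.le hεb.le 2
    have hβ : 512 * (b ^ 2 / ε ^ 2) ≤ n * ρ := by
      have h1 : b ^ 4 / a ^ 4 = b ^ 2 / a ^ 2 * (b ^ 2 / a ^ 2) := by field_simp
      have h2 : 1 ≤ b ^ 2 / a ^ 2 := by
        rw [one_le_div ha2]; exact pow_le_pow_left₀ ha.le hab 2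
      have h3 : 512 * (b ^ 2 / ε ^ 2) ≤ n * (b ^ 2 / a ^ 2) := by
        rw [← mul_div_assoc, ← mul_div_assoc, div_le_div_iff₀ (by positivity) ha2]
        have : 512 * a ^ 2 ≤ n * ε ^ 2 := by linarith
        nlinarith [sq_nonneg b]
      rw [hρ, h1]
      have h4 : 0 ≤ (n : ℝ) * (b ^ 2 / a ^ 2) := by positivity
      nlinarith
    have hnρ : (n : ℝ) ≤ n * ρ := le_mul_of_one_le_right hn'.le hρ1
    rw [mul_div_assoc]
    linarith [hNabs.1]
  -- Rounding up gives N ≤ (3n + 1)ρ, and (3n + 1)/48 ≤ 101n/1600 once n ≥ 34.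
  have hrN : N * r ≤ 101 / 1600 * ε * n := by
    have h1 : (N : ℝ) ≤ (3 * n + 1) * ρ := by linarith [hNabs.2]
    have hr0 : 0 ≤ r := by positivity
    calc N * r ≤ (3 * n + 1) * ρ * r := by gcongr
      _ = (3 * n + 1) * (ε / 48) := by rw [hrρ]; field_simp
      _ ≤ _ := by nlinarith
  refine (pi_deviationEvent_le D hG ha hb hrange hvar hn hε hN hrN).trans ?_
  have hrr : r ≤ a ^ 2 / (16 * b) := by
    rw [hr, div_le_div_iff₀ (by positivity) (by positivity)]
    have h1 : ε * a ^ 2 ≤ b * b ^ 2 := by gcongr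
    have h2 : 0 ≤ a ^ 2 * b * (b * b ^ 2 - ε * a ^ 2) :=
      mul_nonneg (by positivity) (by linarith)
    have h3 : 0 ≤ a ^ 2 * b ^ 4 := by positivity
    nlinarith
  have hcov : (coveringNumber (a ^ 2 / (16 * b)) G N : ENNReal) ≤ coveringNumber r G N :=
    ENat.toENNReal_le.2 (coveringNumber_antitone G N hrr)
  have hx' : (n : ℝ) * ε ^ 2 / (256 * a ^ 2 + 64 * ε * b) = x := by
    rw [hx]; field_simp; ring
  have hxN : x ≤ (N : ℝ) * a ^ 4 / (128 * b ^ 4) := by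
    have h1 : (N : ℝ) * a ^ 4 / (128 * b ^ 4) = N / (128 * ρ) := by rw [hρ]; field_simp
    have h2 : x ≤ n / 64 := by
      rw [hx, div_le_iff₀ (by positivity)]
      have : (n : ℝ) * (ε * ε) ≤ n * (ε * b) := by gcongr
      nlinarith
    have h3 : (n : ℝ) / 64 ≤ N / (128 * ρ) := by
      rw [div_le_div_iff₀ (by norm_num) (by positivity)]
      have : ρ ≤ n * ρ := le_mul_of_one_le_left (by linarith) (by linarith)
      linarith [hNabs.1]
    rw [h1]
    exact h2.trans h3
  rw [hx']
  calc _ ≤ 16 * (coveringNumber r G N : ENNReal) * ENNReal.ofReal (Real.exp (-x)) +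
        4 * (coveringNumber r G N : ENNReal) * ENNReal.ofReal (Real.exp (-x)) := by
        gcongr
    _ = _ := by ring
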